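/- Let $\alpha_1,\alpha_2>0$ be real numbers and let $f(x)=x_1^{\alpha_1}x_2^{\alpha_2}$ for $x=(x_1,x_2)\in\mathbb{R}^2$. Here, for a negative base $t<0$, the power $t^{\alpha_i}$ is understood as $c_i\,|t|^{\alpha_i}$ with an arbitrary fixed real constant $c_i\neq 0$: for an integer exponent, $c_i=(-1)^{\alpha_i}$ gives the ordinary power, and $c_i=1$ gives $|t|^{\alpha_i}$. Let $\Sigma$ be any real positive semidefinite $2\times 2$ matrix with positive diagonal entries, let $X\sim N_2(0,\Sigma)$ be a normal random vector with mean zero and covariance matrix $\Sigma$, and let $$W_{f,\Sigma}=\frac{f(X)^2}{(\nabla f(X))^{T}\,\Sigma\,\nabla f(X)},$$ which is well defined almost surely. Then $$W_{f,\Sigma}\;\sim\;\frac{1}{(\alpha_1+\alpha_2)^2}\,\chi^2_1,$$ where $\chi^2_1$ is the chi-square distribution with one degree of freedom, i.e. the law of $Z^2$ for a standard normal $Z$. In particular, the distribution of $W_{f,\Sigma}$ does not depend on $\Sigma$. -/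

import Mathlib

open MeasureTheory ProbabilityTheory

noncomputable section

/-- The power `x ^ α` on the whole real line: the usual power for `x ≥ 0`, continued to the
negative half-line as `c * (-x) ^ α`, i.e. with the constant `c` playing the role of `(-1) ^ α`.
For an integer exponent and `c = (-1) ^ α` this is the ordinary power (`signedPow_natCast`), for
`c = 1` it is `|x| ^ α` (`signedPow_one`). -/
def signedPow (c α x : ℝ) : ℝ :=
  if 0 ≤ x then x ^ α else c * (-x) ^ α

theorem signedPow_natCast (n : ℕ) (x : ℝ) : signedPow ((-1) ^ n) (n : ℝ) x = x ^ n := by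
  unfold signedPow
  split_ifs with h
  · exact Real.rpow_natCast x n
  · rw [Real.rpow_natCast, ← mul_pow, neg_one_mul, neg_neg]

theorem signedPow_one (α x : ℝ) : signedPow 1 α x = |x| ^ α := by
  unfold signedPow
  split_ifs with h
  · rw [abs_of_nonneg h]
  · rw [one_mul, abs_of_neg (not_le.mp h)]

/-- The bivariate function `x ↦ x₁ ^ α₁ * x₂ ^ α₂`. -/
def bivariateMonomial (c₁ c₂ α₁ α₂ : ℝ) (x : EuclideanSpace ℝ (Fin 2)) : ℝ :=
  signedPow c₁ α₁ (x 0) * signedPow c₂ α₂ (x 1)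

/-- The ratio `f(x)² / (∇f(x)ᵀ Σ ∇f(x))`; evaluated at `X ∼ N(0, Σ)` it is the random variable
`W_{f,Σ}`. -/
def waldRatio {k : ℕ} (f : EuclideanSpace ℝ (Fin k) → ℝ) (S : Matrix (Fin k) (Fin k) ℝ)
    (x : EuclideanSpace ℝ (Fin k)) : ℝ :=
  f x ^ 2 / dotProduct (gradient f x).ofLp (S.mulVec (gradient f x).ofLp)

/-- The chi-square distribution with one degree of freedom: the law of the square of a standard
normal random variable. -/
def chiSquareOne : Measure ℝ :=
  (gaussianReal 0 1).map (fun z => z ^ 2)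

end

/-!
Write `Σ` as the Gram matrix of `v₁, v₂ ∈ ℂ`, so that `X` has the law of `(⟪v₁, Z⟫, ⟪v₂, Z⟫)` with
`Z` standard Gaussian on `ℂ`. The ratio is then homogeneous of degree 2 in `Z`, and the law of `Z`
is rotation invariant, so it suffices to compare the laws of `(α₁ + α₂)² W` and `(Re u)²` for
`Z = u` uniform on the unit circle. With `m = α₁ ⟪v₂, u⟫ v₁ + α₂ ⟪v₁, u⟫ v₂`, the former is the
squared cosine of the angle between `m` and `u`, that is `(1 + Re (N / conj N)) / 2` where
`N = 2 conj(m) u` has the form `c u² + a`. If `v₁, v₂` are linearly independent then `|a| < |c|`,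
and `N / conj N` is a Blaschke product in `u²` vanishing at `0`; such a map preserves the uniform
measure on the circle, so `N / conj N` may be replaced by `u²`. If `v₁` and `v₂` are parallel,
`(α₁ + α₂)² W` is the square of a single standard normal coordinate of `Z`.
-/

noncomputable section

open Metric Real
open scoped BoundedContinuousFunction ComplexConjugate InnerProductSpace Matrix
open Matrix (gram)

instance : MeasurableSpace Circle := borel Circle

instance : BorelSpace Circle := ⟨rfl⟩

local instance : Fact (0 < 2 * π) := ⟨Real.two_pi_pos⟩

@[fun_prop]
lemma continuous_coe_circle : Continuous fun z : Circle => (z : ℂ) := continuous_subtype_val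

/-- The uniform probability measure on the unit circle. -/
def uniformCircle : Measure Circle :=
  (AddCircle.haarAddCircle (T := 2 * π)).map AddCircle.toCircle

instance : IsProbabilityMeasure uniformCircle :=
  Measure.isProbabilityMeasure_map AddCircle.continuous_toCircle.aemeasurable

lemma integral_uniformCircle {f : ℂ → ℂ} (hf : ContinuousOn f (sphere 0 1)) :
    ∫ z : Circle, f z ∂uniformCircle = circleAverage f 0 1 := by
  have hf' : Continuous fun z : Circle => f z :=
    hf.comp_continuous continuous_coe_circle fun z => by simp [Circle.norm_coe z]
  rw [uniformCircle, integral_map AddCircle.continuous_toCircle.aemeasurable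
    hf'.aestronglyMeasurable, AddCircle.integral_haarAddCircle,
    ← AddCircle.intervalIntegral_preimage (2 * π) 0, circleAverage_def]
  simp [AddCircle.toCircle, circleMap]

lemma integral_uniformCircle_of_diffContOnCl {f : ℂ → ℂ} (hf : DiffContOnCl ℂ f (ball 0 1)) :
    ∫ z : Circle, f z ∂uniformCircle = f 0 := by
  have hsphere : ContinuousOn f (sphere 0 1) := hf.continuousOn_ball.mono sphere_subset_closedBall
  rw [integral_uniformCircle hsphere]
  exact DiffContOnCl.circleAverage (by rwa [abs_one])

lemma integral_zpow_eq_of_integral_pow_eq {μ ν : Measure Circle}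
    (h : ∀ n : ℕ, ∫ z : Circle, (z : ℂ) ^ n ∂μ = ∫ z : Circle, (z : ℂ) ^ n ∂ν) (n : ℤ) :
    ∫ z : Circle, (z : ℂ) ^ n ∂μ = ∫ z : Circle, (z : ℂ) ^ n ∂ν := by
  obtain ⟨m, rfl | rfl⟩ := n.eq_nat_or_neg
  · simpa only [zpow_natCast] using h m
  · have hconj (z : Circle) : (z : ℂ) ^ (-(m : ℤ)) = conj ((z : ℂ) ^ m) := by
      rw [zpow_neg, zpow_natCast, map_pow, ← Circle.coe_inv_eq_conj, Circle.coe_inv, inv_pow]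
    simp only [hconj, integral_conj, h]

open Submodule in
theorem ext_of_integral_circle_pow_eq {μ ν : Measure Circle} [IsFiniteMeasure μ]
    [IsFiniteMeasure ν]
    (h : ∀ n : ℕ, ∫ z : Circle, (z : ℂ) ^ n ∂μ = ∫ z : Circle, (z : ℂ) ^ n ∂ν) : μ = ν := by
  let incl : Circle →ᵇ ℂ := .mkOfCompact ⟨(↑), continuous_coe_circle⟩
  let powers : Submonoid (Circle →ᵇ ℂ) :=
    { carrier := {g | ∃ n : ℤ, ∀ z, g z = (z : ℂ) ^ n}
      one_mem' := ⟨0, by simp⟩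
      mul_mem' := by
        rintro f g ⟨m, hm⟩ ⟨n, hn⟩
        exact ⟨m + n, fun z => by simp [hm, hn, zpow_add₀]⟩ }
  have hpowers : Submonoid.closure ({incl} ∪ star {incl}) ≤ powers := by
    rw [Submonoid.closure_le, Set.star_singleton, Set.union_subset_iff, Set.singleton_subset_iff,
      Set.singleton_subset_iff]
    exact ⟨⟨1, fun z => (zpow_one _).symm⟩,
      ⟨-1, fun z => (Circle.coe_inv_eq_conj z).symm.trans (zpow_neg_one _).symm⟩⟩
  refine ext_of_forall_mem_subalgebra_integral_eq_of_polish (𝕜 := ℂ)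
    (A := StarAlgebra.adjoin ℂ {incl}) ?_ fun g hg => ?_
  · intro z w hzw
    refine ⟨incl, ⟨_, ⟨incl, StarAlgebra.self_mem_adjoin_singleton ℂ incl, rfl⟩, rfl⟩, ?_⟩
    exact fun heq => hzw (Circle.coe_injective heq)
  · rw [← StarSubalgebra.mem_toSubalgebra, StarAlgebra.adjoin_toSubalgebra,
      ← Subalgebra.mem_toSubmodule, Algebra.adjoin_eq_span] at hg
    induction hg using span_induction with
    | mem g hg =>
      obtain ⟨n, hn⟩ := hpowers hg
      simpa only [hn] using integral_zpow_eq_of_integral_pow_eq h n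
    | zero => simp
    | add f g _ _ hf hg =>
      simp only [BoundedContinuousFunction.add_apply]
      rw [integral_add (f.integrable μ) (g.integrable μ),
        integral_add (f.integrable ν) (g.integrable ν), hf, hg]
    | smul c g _ hg =>
      simp only [BoundedContinuousFunction.smul_apply, integral_smul, hg]

/-- Löwner's lemma. By the mean value property every moment `∫ (b z) ^ n` equals `B 0 ^ n`. -/
theorem measurePreserving_uniformCircle_of_diffContOnCl {B : ℂ → ℂ} {b : Circle → Circle}
    (hB : DiffContOnCl ℂ B (ball 0 1)) (hB₀ : B 0 = 0) (hb : ∀ z : Circle, (b z : ℂ) = B z) :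
    MeasurePreserving b uniformCircle uniformCircle := by
  have hb_cont : Continuous b := by
    have hBz : Continuous fun z : Circle => B z :=
      hB.continuousOn_ball.comp_continuous continuous_coe_circle fun z => by
        simp [Circle.norm_coe z]
    exact continuous_induced_rng.2 (hBz.congr fun z => (hb z).symm)
  refine ⟨hb_cont.measurable, ?_⟩
  have := Measure.isProbabilityMeasure_map (μ := uniformCircle) hb_cont.aemeasurable
  refine ext_of_integral_circle_pow_eq fun n => ?_
  have hBn : DiffContOnCl ℂ (fun z => B z ^ n) (ball 0 1) :=
    ⟨hB.differentiableOn.pow n, hB.continuousOn.pow n⟩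
  have hidn : DiffContOnCl ℂ (fun z : ℂ => z ^ n) (ball 0 1) :=
    (differentiable_pow n).diffContOnCl
  calc ∫ z, (z : ℂ) ^ n ∂uniformCircle.map b
      = ∫ z : Circle, B z ^ n ∂uniformCircle := by
        have hpow : Continuous fun z : Circle => (z : ℂ) ^ n := continuous_coe_circle.pow n
        rw [integral_map hb_cont.aemeasurable hpow.aestronglyMeasurable]
        simp only [hb]
    _ = B 0 ^ n := integral_uniformCircle_of_diffContOnCl hBn
    _ = ∫ z : Circle, (z : ℂ) ^ n ∂uniformCircle := by
        rw [integral_uniformCircle_of_diffContOnCl hidn, hB₀]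

lemma measurePreserving_mul_left_circle (w : Circle) :
    MeasurePreserving (w * ·) uniformCircle uniformCircle :=
  measurePreserving_uniformCircle_of_diffContOnCl (B := fun z => w * z)
    (by fun_prop : Differentiable ℂ fun z : ℂ => w * z).diffContOnCl (by simp) fun z => by simp

lemma measurePreserving_pow_circle {n : ℕ} (hn : n ≠ 0) :
    MeasurePreserving (fun z : Circle => z ^ n) uniformCircle uniformCircle :=
  measurePreserving_uniformCircle_of_diffContOnCl (B := fun z => z ^ n)
    (differentiable_pow n).diffContOnCl (by simp [hn]) fun z => by simp

theorem map_smul_norm_eq (γ : Measure ℂ) [SFinite γ] [SMulInvariantMeasure Circle ℂ γ] :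
    (γ.prod uniformCircle).map (fun p => p.2 • (‖p.1‖ : ℂ)) = γ := by
  have hmeas : Measurable fun p : ℂ × Circle => p.2 • (‖p.1‖ : ℂ) := by fun_prop
  have hrotate (z : ℂ) (u : Circle) : u • z = (Circle.exp z.arg * u) • (‖z‖ : ℂ) := by
    rw [Circle.smul_def, Circle.smul_def, Circle.coe_mul, Circle.coe_exp, smul_eq_mul, smul_eq_mul,
      ← mul_rotate, Complex.norm_mul_exp_arg_mul_I, mul_comm]
  refine Measure.ext_of_lintegral _ fun f hf => ?_
  calc ∫⁻ z, f z ∂(γ.prod uniformCircle).map (fun p => p.2 • (‖p.1‖ : ℂ))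
      = ∫⁻ z, ∫⁻ u : Circle, f (u • (‖z‖ : ℂ)) ∂uniformCircle ∂γ := by
        rw [lintegral_map hf hmeas]
        exact lintegral_prod _ (hf.comp hmeas).aemeasurable
    _ = ∫⁻ z, ∫⁻ u : Circle, f (u • z) ∂uniformCircle ∂γ := by
        refine lintegral_congr fun z => ?_
        simp only [hrotate z]
        exact ((measurePreserving_mul_left_circle _).lintegral_comp
          (f := fun u : Circle => f (u • (‖z‖ : ℂ))) (by fun_prop)).symm
    _ = ∫⁻ u : Circle, ∫⁻ z, f (u • z) ∂γ ∂uniformCircle := by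
        rw [lintegral_lintegral_swap]
        fun_prop
    _ = ∫⁻ z, f z ∂γ := by
        simp_rw [(measurePreserving_smul (_ : Circle) γ).lintegral_comp hf, lintegral_const,
          measure_univ, mul_one]

theorem map_eq_of_map_uniformCircle_eq (γ : Measure ℂ) [SFinite γ] [SMulInvariantMeasure Circle ℂ γ]
    {k : ℕ} {F H : ℂ → ℝ} (hF : Measurable F) (hH : Measurable H)
    (hF_smul : ∀ (r : ℝ) (z : ℂ), 0 ≤ r → F (r * z) = r ^ k * F z)
    (hH_smul : ∀ (r : ℝ) (z : ℂ), 0 ≤ r → H (r * z) = r ^ k * H z)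
    (hFH : uniformCircle.map (fun u : Circle => F u) = uniformCircle.map (fun u : Circle => H u)) :
    γ.map F = γ.map H := by
  have hpolar {G : ℂ → ℝ} (hG : Measurable G)
      (hG_smul : ∀ (r : ℝ) (z : ℂ), 0 ≤ r → G (r * z) = r ^ k * G z) :
      γ.map G = ((γ.map (fun z => ‖z‖ ^ k)).prod (uniformCircle.map fun u : Circle => G u)).map
        (fun p => p.1 * p.2) := by
    rw [Measure.map_prod_map _ _ (by fun_prop) (by fun_prop),
      Measure.map_map (by fun_prop) (by fun_prop)]
    nth_rw 1 [← map_smul_norm_eq γ]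
    rw [Measure.map_map hG (by fun_prop)]
    refine congrArg (Measure.map · _) (funext fun p => ?_)
    simp [Circle.smul_def, ← hG_smul, mul_comm]
  rw [hpolar hF hF_smul, hpolar hH hH_smul, hFH]

instance smulInvariantMeasure_circle_stdGaussian :
    SMulInvariantMeasure Circle ℂ (stdGaussian ℂ) where
  measure_preimage_smul u s hs := by
    rw [← Measure.map_apply (measurable_const_smul u) hs]
    exact congrArg (· s) (stdGaussian_map (rotation u))

open scoped ComplexOrder MatrixOrder in
lemma exists_gram_eq {𝕜 E n : Type*} [RCLike 𝕜] [NormedAddCommGroup E] [InnerProductSpace 𝕜 E]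
    [Fintype n] (b : OrthonormalBasis n 𝕜 E) {S : Matrix n n 𝕜} (hS : S.PosSemidef) :
    ∃ v : n → E, gram 𝕜 v = S := by
  classical
  obtain ⟨B, rfl⟩ := CStarAlgebra.nonneg_iff_eq_star_mul_self.1 hS.nonneg
  refine ⟨fun j => b.repr.symm (WithLp.toLp 2 (B.col j)), ?_⟩
  rw [Matrix.gram_eq_conjTranspose_mul b, Matrix.star_eq_conjTranspose]
  simp only [LinearIsometryEquiv.apply_symm_apply, Matrix.col_apply]
  rfl

section Gram

variable {E ι : Type*} [NormedAddCommGroup E] [InnerProductSpace ℝ E]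

/-- The coordinates `(⟪v i, z⟫)_i` of `z`. For a standard Gaussian `z` they form a centred Gaussian
vector whose covariance is the Gram matrix of `v`. -/
def innerCoords (v : ι → E) : E →L[ℝ] EuclideanSpace ℝ ι :=
  (EuclideanSpace.equiv ι ℝ).symm.toContinuousLinearMap ∘L
    ContinuousLinearMap.pi fun i => innerSL ℝ (v i)

lemma innerCoords_apply (v : ι → E) (z : E) (i : ι) : innerCoords v z i = ⟪v i, z⟫_ℝ := rfl

variable [Fintype ι]

lemma inner_innerCoords (v : ι → E) (z : E) (t : EuclideanSpace ℝ ι) :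
    ⟪innerCoords v z, t⟫_ℝ = ⟪z, ∑ i, t i • v i⟫_ℝ := by
  simp [PiLp.inner_apply, innerCoords_apply, inner_sum, inner_smul_right, real_inner_comm]

lemma dotProduct_gram_mulVec (v : ι → E) (g : ι → ℝ) :
    g ⬝ᵥ gram ℝ v *ᵥ g = ‖∑ i, g i • v i‖ ^ 2 := by
  rw [← real_inner_self_eq_norm_sq, ← Matrix.star_dotProduct_gram_mulVec, star_trivial]

end Gram

section Gaussian

variable {E : Type*} [NormedAddCommGroup E] [InnerProductSpace ℝ E] [FiniteDimensional ℝ E]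
  [MeasurableSpace E] [BorelSpace E]

theorem map_innerCoords_stdGaussian {ι : Type*} [Fintype ι] [DecidableEq ι] (v : ι → E) :
    (stdGaussian E).map (innerCoords v) = multivariateGaussian 0 (gram ℝ v) := by
  refine Measure.ext_of_charFun (funext fun t => ?_)
  calc charFun ((stdGaussian E).map (innerCoords v)) t
      = charFun (stdGaussian E) (∑ i, t i • v i) := by
        rw [charFun_apply, integral_map (by fun_prop) (by fun_prop), charFun_apply]
        simp only [inner_innerCoords]
    _ = charFun (multivariateGaussian 0 (gram ℝ v)) t := by
        rw [charFun_stdGaussian, charFun_multivariateGaussian (Matrix.posSemidef_gram ℝ v),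
          dotProduct_gram_mulVec, inner_zero_right]
        norm_num [neg_div]

lemma map_inner_stdGaussian (v : E) :
    (stdGaussian E).map (fun z => ⟪v, z⟫_ℝ) = gaussianReal 0 (‖v‖₊ ^ 2) := by
  have hgauss := (isGaussian_stdGaussian (E := E)).map_eq_gaussianReal (innerSL ℝ v)
  rwa [integral_strongDual_stdGaussian, variance_dual_stdGaussian, innerSL_apply_norm,
    Real.toNNReal_pow (norm_nonneg v), norm_toNNReal] at hgauss

lemma ae_inner_ne_zero_stdGaussian {v : E} (hv : v ≠ 0) : ∀ᵐ z ∂stdGaussian E, ⟪v, z⟫_ℝ ≠ 0 := by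
  have := nullSingletonClass_gaussianReal (μ := 0) (v := ‖v‖₊ ^ 2) (by simpa using hv)
  refine ae_of_ae_map (μ := stdGaussian E) (f := fun z => ⟪v, z⟫_ℝ) (p := (· ≠ 0))
    (by fun_prop) ?_
  rw [map_inner_stdGaussian]
  exact Measure.ae_ne _ _

lemma ae_ne_zero_multivariateGaussian_gram {ι : Type*} [Fintype ι] [DecidableEq ι] {v : ι → E}
    {i : ι} (hv : v i ≠ 0) : ∀ᵐ x ∂multivariateGaussian 0 (gram ℝ v), x i ≠ 0 := by
  have hmeas : Measurable fun x : EuclideanSpace ℝ ι => x i := by fun_prop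
  rw [← map_innerCoords_stdGaussian]
  exact (ae_map_iff (by fun_prop) (hmeas (measurableSet_singleton 0).compl)).2
    (ae_inner_ne_zero_stdGaussian hv)

lemma map_inner_sq_stdGaussian {e : E} (he : ‖e‖ = 1) :
    (stdGaussian E).map (fun z => ⟪e, z⟫_ℝ ^ 2) = chiSquareOne := by
  have he' : ‖e‖₊ ^ 2 = 1 := by rw [← norm_toNNReal, he, Real.toNNReal_one, one_pow]
  rw [chiSquareOne, ← he', ← map_inner_stdGaussian, Measure.map_map (by fun_prop) (by fun_prop)]
  rfl

end Gaussian

lemma signedPow_ne_zero {c x : ℝ} (hc : c ≠ 0) (α : ℝ) (hx : x ≠ 0) : signedPow c α x ≠ 0 := by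
  unfold signedPow
  split_ifs with h
  · exact (Real.rpow_pos_of_pos (lt_of_le_of_ne h hx.symm) α).ne'
  · exact mul_ne_zero hc (Real.rpow_pos_of_pos (by linarith) α).ne'

open Filter Topology in
lemma hasDerivAt_signedPow (c α : ℝ) {x : ℝ} (hx : x ≠ 0) :
    HasDerivAt (signedPow c α) (signedPow c α x * (α / x)) x := by
  rcases hx.lt_or_gt with h | h
  · have heq : signedPow c α =ᶠ[𝓝 x] fun y => c * (-y) ^ α := by
      filter_upwards [eventually_lt_nhds h] with y hy
      exact if_neg hy.not_ge
    have hderiv := ((hasDerivAt_neg x).rpow_const (p := α) (.inl (neg_ne_zero.2 hx))).const_mul c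
    refine (hderiv.congr_of_eventuallyEq heq).congr_deriv ?_
    rw [heq.self_of_nhds, Real.rpow_sub_one (neg_ne_zero.2 hx)]
    field
  · have heq : signedPow c α =ᶠ[𝓝 x] fun y => y ^ α := by
      filter_upwards [eventually_gt_nhds h] with y hy
      exact if_pos hy.le
    refine ((Real.hasDerivAt_rpow_const (.inl hx)).congr_of_eventuallyEq heq).congr_deriv ?_
    rw [heq.self_of_nhds, Real.rpow_sub_one hx]
    field

lemma gradient_bivariateMonomial (c₁ c₂ α₁ α₂ : ℝ) {x : EuclideanSpace ℝ (Fin 2)}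
    (h₀ : x 0 ≠ 0) (h₁ : x 1 ≠ 0) :
    gradient (bivariateMonomial c₁ c₂ α₁ α₂) x =
      bivariateMonomial c₁ c₂ α₁ α₂ x • !₂[α₁ / x 0, α₂ / x 1] := by
  have hproj (i : Fin 2) : HasFDerivAt (fun y : EuclideanSpace ℝ (Fin 2) => y i)
      (EuclideanSpace.proj (𝕜 := ℝ) i) x :=
    (EuclideanSpace.proj (𝕜 := ℝ) i).hasFDerivAt
  have hmul := ((hasDerivAt_signedPow c₁ α₁ h₀).comp_hasFDerivAt x (hproj 0)).mul
    ((hasDerivAt_signedPow c₂ α₂ h₁).comp_hasFDerivAt x (hproj 1))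
  refine (hasGradientAt_iff_hasFDerivAt.2 (hmul.congr_fderiv ?_)).gradient
  ext v
  simp only [bivariateMonomial, map_smul, InnerProductSpace.toDual_apply_apply, PiLp.inner_apply,
    RCLike.inner_apply, ringHom_apply, Fin.sum_univ_two, Matrix.cons_val_zero, Matrix.cons_val_one,
    Matrix.cons_val_fin_one, Function.comp_apply, add_apply, smul_apply, PiLp.proj_apply,
    smul_eq_mul]
  ring

lemma waldRatio_eq_of_gradient_eq_smul {k : ℕ} {f : EuclideanSpace ℝ (Fin k) → ℝ}
    (S : Matrix (Fin k) (Fin k) ℝ) {x g : EuclideanSpace ℝ (Fin k)} (hf : f x ≠ 0)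
    (hg : gradient f x = f x • g) : waldRatio f S x = (g.ofLp ⬝ᵥ S *ᵥ g.ofLp)⁻¹ := by
  rw [waldRatio, hg, WithLp.ofLp_smul, Matrix.mulVec_smul, smul_dotProduct, dotProduct_smul,
    smul_eq_mul, smul_eq_mul, ← mul_assoc, ← sq, div_mul_cancel_left₀ (pow_ne_zero 2 hf)]

section
variable {E : Type*} [NormedAddCommGroup E] [InnerProductSpace ℝ E]

/-- The closed form that `waldRatio` takes for `bivariateMonomial` and `gram ℝ v` at points with
nonzero coordinates: as `∇ log |f| = (α₁ / x₁, α₂ / x₂)`, the factor `f(x)²` cancels. Clearing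
denominators by `x₁ x₂` makes the expression homogeneous of degree 2 on the whole plane. -/
def monomialWaldRatio (α₁ α₂ : ℝ) (v : Fin 2 → E) (x : EuclideanSpace ℝ (Fin 2)) : ℝ :=
  (x 0 * x 1) ^ 2 / ‖(α₁ * x 1) • v 0 + (α₂ * x 0) • v 1‖ ^ 2

lemma measurable_monomialWaldRatio (α₁ α₂ : ℝ) (v : Fin 2 → E) :
    Measurable (monomialWaldRatio α₁ α₂ v) := by
  unfold monomialWaldRatio
  have hnum : Continuous fun x : EuclideanSpace ℝ (Fin 2) => (x 0 * x 1) ^ 2 := by fun_prop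
  have hden : Continuous fun x : EuclideanSpace ℝ (Fin 2) =>
    ‖(α₁ * x 1) • v 0 + (α₂ * x 0) • v 1‖ ^ 2 := by fun_prop
  exact hnum.measurable.div hden.measurable

lemma monomialWaldRatio_smul (α₁ α₂ : ℝ) (v : Fin 2 → E) (r : ℝ) (x : EuclideanSpace ℝ (Fin 2)) :
    monomialWaldRatio α₁ α₂ v (r • x) = r ^ 2 * monomialWaldRatio α₁ α₂ v x := by
  have hden : (α₁ * (r • x) 1) • v 0 + (α₂ * (r • x) 0) • v 1 =
      r • ((α₁ * x 1) • v 0 + (α₂ * x 0) • v 1) := by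
    simp only [PiLp.smul_apply, smul_eq_mul]
    module
  rw [monomialWaldRatio, monomialWaldRatio, hden, norm_smul, mul_pow ‖r‖, Real.norm_eq_abs, sq_abs,
    PiLp.smul_apply, PiLp.smul_apply, smul_eq_mul, smul_eq_mul]
  rcases eq_or_ne r 0 with rfl | hr
  · simp
  · field

lemma waldRatio_bivariateMonomial {c₁ c₂ : ℝ} (hc₁ : c₁ ≠ 0) (hc₂ : c₂ ≠ 0) (α₁ α₂ : ℝ)
    (v : Fin 2 → E) {x : EuclideanSpace ℝ (Fin 2)} (h₀ : x 0 ≠ 0) (h₁ : x 1 ≠ 0) :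
    waldRatio (bivariateMonomial c₁ c₂ α₁ α₂) (gram ℝ v) x = monomialWaldRatio α₁ α₂ v x := by
  have hf : bivariateMonomial c₁ c₂ α₁ α₂ x ≠ 0 :=
    mul_ne_zero (signedPow_ne_zero hc₁ _ h₀) (signedPow_ne_zero hc₂ _ h₁)
  have hden : (α₁ * x 1) • v 0 + (α₂ * x 0) • v 1 =
      (x 0 * x 1) • ((α₁ / x 0) • v 0 + (α₂ / x 1) • v 1) := by
    match_scalars <;> field
  rw [waldRatio_eq_of_gradient_eq_smul _ hf (gradient_bivariateMonomial _ _ _ _ h₀ h₁),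
    dotProduct_gram_mulVec, monomialWaldRatio, hden, norm_smul, mul_pow ‖_‖, Real.norm_eq_abs,
    sq_abs, div_mul_cancel_left₀ (pow_ne_zero 2 (mul_ne_zero h₀ h₁))]
  simp [Fin.sum_univ_two]

lemma monomialWaldRatio_innerCoords {α₁ α₂ : ℝ} (hα : α₁ + α₂ ≠ 0) (v : Fin 2 → E) (z : E) :
    monomialWaldRatio α₁ α₂ v (innerCoords v z) =
      ⟪(α₁ * ⟪v 1, z⟫_ℝ) • v 0 + (α₂ * ⟪v 0, z⟫_ℝ) • v 1, z⟫_ℝ ^ 2 /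
        ‖(α₁ * ⟪v 1, z⟫_ℝ) • v 0 + (α₂ * ⟪v 0, z⟫_ℝ) • v 1‖ ^ 2 / (α₁ + α₂) ^ 2 := by
  have hinner : ⟪(α₁ * ⟪v 1, z⟫_ℝ) • v 0 + (α₂ * ⟪v 0, z⟫_ℝ) • v 1, z⟫_ℝ =
      (α₁ + α₂) * (⟪v 0, z⟫_ℝ * ⟪v 1, z⟫_ℝ) := by
    rw [inner_add_left, real_inner_smul_left, real_inner_smul_left]
    ring
  rw [hinner, div_right_comm, mul_pow, mul_div_cancel_left₀ _ (pow_ne_zero 2 hα)]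
  rfl

lemma monomialWaldRatio_innerCoords_of_smul (α₁ α₂ : ℝ) {v : Fin 2 → E} {t : ℝ}
    (hv : v 0 ≠ 0) (ht : t ≠ 0) (hvt : v 1 = t • v 0) (z : E) :
    monomialWaldRatio α₁ α₂ v (innerCoords v z) =
      ⟪‖v 0‖⁻¹ • v 0, z⟫_ℝ ^ 2 / (α₁ + α₂) ^ 2 := by
  have hden : (α₁ * (t * ⟪v 0, z⟫_ℝ)) • v 0 + (α₂ * ⟪v 0, z⟫_ℝ) • t • v 0 =
      ((α₁ + α₂) * t * ⟪v 0, z⟫_ℝ) • v 0 := by module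
  rw [monomialWaldRatio, innerCoords_apply, innerCoords_apply, hvt, real_inner_smul_left,
    real_inner_smul_left, hden, norm_smul, mul_pow ‖_‖, Real.norm_eq_abs, sq_abs]
  have hnorm : ‖v 0‖ ≠ 0 := norm_ne_zero_iff.2 hv
  rcases eq_or_ne ⟪v 0, z⟫_ℝ 0 with hz | hz
  · simp [hz]
  · field

end

lemma re_sq_div_normSq {m : ℂ} (hm : m ≠ 0) : m.re ^ 2 / ‖m‖ ^ 2 = (1 + (m / conj m).re) / 2 := by
  have hnormSq : m.re ^ 2 + m.im ^ 2 ≠ 0 := by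
    rwa [sq, sq, ← Complex.normSq_apply, Complex.normSq_eq_zero.ne]
  rw [Complex.div_re, Complex.normSq_conj, Complex.conj_re, Complex.conj_im, Complex.sq_norm,
    Complex.normSq_apply]
  field_simp
  ring

theorem exists_measurePreserving_circle_coe_eq {a c : ℂ} (hac : ‖a‖ < ‖c‖) :
    ∃ b : Circle → Circle, MeasurePreserving b uniformCircle uniformCircle ∧
      ∀ ζ : Circle, (b ζ : ℂ) = (c * ζ + a) / conj (c * ζ + a) := by
  have hden {z : ℂ} (hz : ‖z‖ ≤ 1) : conj c + conj a * z ≠ 0 := by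
    intro h
    have : ‖c‖ ≤ ‖a‖ := calc
      ‖c‖ = ‖conj a * z‖ := by rw [← Complex.norm_conj, eq_neg_of_add_eq_zero_left h, norm_neg]
      _ ≤ ‖a‖ := by
        rw [norm_mul, Complex.norm_conj]
        exact mul_le_of_le_one_right (norm_nonneg a) hz
    exact this.not_gt hac
  have hconj (ζ : Circle) : conj (c * ζ + a) = (conj c + conj a * ζ) / ζ := by
    rw [map_add, map_mul, ← Circle.coe_inv_eq_conj, Circle.coe_inv]
    field_simp
  have hne (ζ : Circle) : conj (c * ζ + a) ≠ 0 := by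
    rw [hconj]
    exact div_ne_zero (hden ζ.norm_coe.le) ζ.coe_ne_zero
  refine ⟨fun ζ => Circle.ofConjDivSelf (conj (c * ζ + a)) (hne ζ), ?_, fun ζ => ?_⟩
  · -- On the circle the quotient agrees with a Blaschke product, as `conj ζ = ζ⁻¹`; its pole lies
    -- outside the closed disc because `‖a‖ < ‖c‖`.
    refine measurePreserving_uniformCircle_of_diffContOnCl
      (B := fun z => z * (c * z + a) / (conj c + conj a * z)) ?_ (by simp) fun ζ => ?_
    · refine DifferentiableOn.diffContOnCl_ball (U := closedBall 0 1) ?_ subset_rfl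
      refine DifferentiableOn.div (by fun_prop) (by fun_prop) fun z hz => hden (by simpa using hz)
    · change conj (conj (c * ζ + a)) / conj (c * ζ + a) = _
      rw [Complex.conj_conj, hconj]
      field_simp
  · change conj (conj (c * ζ + a)) / conj (c * ζ + a) = _
    rw [Complex.conj_conj]

theorem map_re_sq_div_normSq_uniformCircle {a c : ℂ} (hac : ‖a‖ < ‖c‖) :
    uniformCircle.map (fun u : Circle => (c * u ^ 2 + a).re ^ 2 / ‖c * u ^ 2 + a‖ ^ 2) =
      uniformCircle.map (fun u : Circle => (u : ℂ).re ^ 2) := by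
  obtain ⟨b, hb, hb_coe⟩ := exists_measurePreserving_circle_coe_eq hac
  have hsq := measurePreserving_pow_circle two_ne_zero
  have hcos : MeasurePreserving (fun u : Circle => (1 + (u : ℂ).re) / 2) uniformCircle _ :=
    Measurable.measurePreserving (by fun_prop) _
  have hleft (u : Circle) :
      (c * u ^ 2 + a).re ^ 2 / ‖c * u ^ 2 + a‖ ^ 2 = (1 + (b (u ^ 2) : ℂ).re) / 2 := by
    have hne : c * (u : ℂ) ^ 2 + a ≠ 0 := fun h =>
      (b (u ^ 2)).coe_ne_zero (by rw [hb_coe, Circle.coe_pow, h, zero_div])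
    rw [re_sq_div_normSq hne, hb_coe, Circle.coe_pow]
  have hright (u : Circle) : (u : ℂ).re ^ 2 = (1 + ((u ^ 2 : Circle) : ℂ).re) / 2 := by
    simpa [Circle.norm_coe u, ← Circle.coe_inv_eq_conj, ← sq] using re_sq_div_normSq u.coe_ne_zero
  simp only [hleft, hright]
  exact (hcos.comp (hb.comp hsq)).map_eq.trans (hcos.comp hsq).map_eq.symm

lemma norm_add_mul_conj_lt {α₁ α₂ : ℝ} (hα : 0 < α₁ * α₂) {p : ℂ} (hp : p.im ≠ 0) :
    ‖α₁ * p + α₂ * conj p‖ < ‖(α₁ + α₂) * p‖ := by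
  refine lt_of_pow_lt_pow_left₀ 2 (norm_nonneg _) (sub_pos.1 ?_)
  have hdiff : ‖(α₁ + α₂) * p‖ ^ 2 - ‖α₁ * p + α₂ * conj p‖ ^ 2 = 4 * (α₁ * α₂) * p.im ^ 2 := by
    simp only [Complex.sq_norm, Complex.normSq_apply, Complex.mul_re, Complex.add_re,
      Complex.ofReal_re, Complex.add_im, Complex.ofReal_im, Complex.mul_im, Complex.conj_re,
      Complex.conj_im]
    ring
  rw [hdiff]
  positivity

lemma two_mul_conj_smul_add_smul_mul (α₁ α₂ : ℝ) (v w : ℂ) (u : Circle) :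
    2 * (conj ((α₁ * ⟪w, u⟫_ℝ) • v + (α₂ * ⟪v, u⟫_ℝ) • w) * u) =
      (α₁ + α₂) * conj (v * w) * u ^ 2 + (α₁ * (conj v * w) + α₂ * conj (conj v * w)) := by
  have hu : (u : ℂ) * conj (u : ℂ) = 1 := by
    rw [← Circle.coe_inv_eq_conj, ← Circle.coe_mul, mul_inv_cancel, Circle.coe_one]
  simp only [Complex.real_smul, Complex.ofReal_mul, Complex.inner, Complex.re_eq_add_conj, map_add,
    map_mul, Complex.conj_conj, map_div₀, Complex.conj_ofReal, map_ofNat]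
  linear_combination (α₁ * (conj v * w) + α₂ * (v * conj w)) * hu

lemma map_monomialWaldRatio_uniformCircle {α₁ α₂ : ℝ} (hα : 0 < α₁ * α₂) {v : Fin 2 → ℂ}
    (hv : (conj (v 0) * v 1).im ≠ 0) :
    uniformCircle.map (fun u : Circle => monomialWaldRatio α₁ α₂ v (innerCoords v u)) =
      uniformCircle.map (fun u : Circle => (u : ℂ).re ^ 2 / (α₁ + α₂) ^ 2) := by
  have hsum : α₁ + α₂ ≠ 0 := by
    intro h
    rw [eq_neg_of_add_eq_zero_left h] at hα
    nlinarith [mul_self_nonneg α₂]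
  set a : ℂ := α₁ * (conj (v 0) * v 1) + α₂ * conj (conj (v 0) * v 1)
  set c : ℂ := (α₁ + α₂) * conj (v 0 * v 1)
  have hac : ‖a‖ < ‖c‖ := by
    refine (norm_add_mul_conj_lt hα hv).trans_eq ?_
    simp [c]
  have hratio (u : Circle) : monomialWaldRatio α₁ α₂ v (innerCoords v u) =
      (c * u ^ 2 + a).re ^ 2 / ‖c * u ^ 2 + a‖ ^ 2 / (α₁ + α₂) ^ 2 := by
    have hre (m : ℂ) : (2 * (conj m * u)).re = 2 * ⟪m, u⟫_ℝ := by
      rw [Complex.inner, mul_comm (conj m)]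
      simp
    have hnorm (m : ℂ) : ‖2 * (conj m * u)‖ = 2 * ‖m‖ := by simp [Circle.norm_coe u]
    rw [← two_mul_conj_smul_add_smul_mul, monomialWaldRatio_innerCoords hsum, hre, hnorm, mul_pow,
      mul_pow, mul_div_mul_left _ _ (pow_ne_zero 2 two_ne_zero)]
  have hscaled := congrArg (Measure.map (· / (α₁ + α₂) ^ 2))
    (map_re_sq_div_normSq_uniformCircle hac)
  rw [Measure.map_map (by fun_prop) (by fun_prop),
    Measure.map_map (by fun_prop) (by fun_prop)] at hscaled
  simpa only [hratio, Function.comp_def] using hscaled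

lemma exists_eq_smul_of_im_conj_mul_eq_zero {v w : ℂ} (hv : v ≠ 0) (h : (conj v * w).im = 0) :
    ∃ t : ℝ, w = t • v := by
  refine ⟨(conj v * w).re / Complex.normSq v, ?_⟩
  have hre : ((conj v * w).re : ℂ) = conj v * w := Complex.ext rfl (by simp [h])
  have hconj : conj v ≠ 0 := (map_ne_zero _).2 hv
  rw [Complex.real_smul, Complex.ofReal_div, hre, Complex.normSq_eq_conj_mul_self]
  field

theorem map_monomialWaldRatio_stdGaussian {α₁ α₂ : ℝ} (hα : 0 < α₁ * α₂) {v : Fin 2 → ℂ}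
    (hv : ∀ i, v i ≠ 0) :
    (stdGaussian ℂ).map (fun z => monomialWaldRatio α₁ α₂ v (innerCoords v z)) =
      chiSquareOne.map (fun w => w / (α₁ + α₂) ^ 2) := by
  have hchiSquare {e : ℂ} (he : ‖e‖ = 1) :
      (stdGaussian ℂ).map (fun z => ⟪e, z⟫_ℝ ^ 2 / (α₁ + α₂) ^ 2) =
        chiSquareOne.map (fun w => w / (α₁ + α₂) ^ 2) := by
    rw [← map_inner_sq_stdGaussian he, Measure.map_map (by fun_prop) (by fun_prop)]
    rfl
  by_cases him : (conj (v 0) * v 1).im = 0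
  · obtain ⟨t, hvt⟩ := exists_eq_smul_of_im_conj_mul_eq_zero (hv 0) him
    have ht : t ≠ 0 := fun ht => hv 1 (by rw [hvt, ht, zero_smul])
    simp only [monomialWaldRatio_innerCoords_of_smul α₁ α₂ (hv 0) ht hvt]
    exact hchiSquare (norm_smul_inv_norm (𝕜 := ℝ) (hv 0))
  · rw [← hchiSquare norm_one]
    refine map_eq_of_map_uniformCircle_eq (k := 2) _
      ((measurable_monomialWaldRatio α₁ α₂ v).comp (by fun_prop)) (by fun_prop)
      (fun r z _ => ?_) (fun r z _ => ?_) ?_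
    · rw [← Complex.real_smul, map_smul, monomialWaldRatio_smul]
    · rw [← Complex.real_smul, real_inner_smul_right, mul_pow, mul_div_assoc]
    · simpa [Complex.inner] using map_monomialWaldRatio_uniformCircle hα him

theorem theorem3p1_general (α₁ α₂ : ℝ) (hα : 0 < α₁ * α₂)
    (c₁ c₂ : ℝ) (hc₁ : c₁ ≠ 0) (hc₂ : c₂ ≠ 0)
    (S : Matrix (Fin 2) (Fin 2) ℝ) (hS : S.PosSemidef) (hdiag : ∀ i, 0 < S i i)
    {Ω : Type*} [MeasurableSpace Ω] (P : Measure Ω)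
    (X : Ω → EuclideanSpace ℝ (Fin 2)) (hX : HasLaw X (multivariateGaussian 0 S) P) :
    HasLaw (fun ω => waldRatio (bivariateMonomial c₁ c₂ α₁ α₂) S (X ω))
      (chiSquareOne.map (fun w => w / (α₁ + α₂) ^ 2)) P := by
  obtain ⟨v, rfl⟩ := exists_gram_eq Complex.orthonormalBasisOneI hS
  have hv (i : Fin 2) : v i ≠ 0 := fun h => (hdiag i).ne' (by simp [h])
  have hmeas := measurable_monomialWaldRatio α₁ α₂ v
  have hlaw : HasLaw (monomialWaldRatio α₁ α₂ v) (chiSquareOne.map (fun w => w / (α₁ + α₂) ^ 2))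
      (multivariateGaussian 0 (gram ℝ v)) := by
    refine ⟨hmeas.aemeasurable, ?_⟩
    rw [← map_innerCoords_stdGaussian, Measure.map_map hmeas (by fun_prop)]
    exact map_monomialWaldRatio_stdGaussian hα hv
  have hclosed : waldRatio (bivariateMonomial c₁ c₂ α₁ α₂) (gram ℝ v)
      =ᵐ[multivariateGaussian 0 (gram ℝ v)] monomialWaldRatio α₁ α₂ v := by
    filter_upwards [ae_ne_zero_multivariateGaussian_gram (hv 0),
      ae_ne_zero_multivariateGaussian_gram (hv 1)] with x h₀ h₁
    exact waldRatio_bivariateMonomial hc₁ hc₂ α₁ α₂ v h₀ h₁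
  exact (hlaw.congr hclosed).fun_comp hX

end

theorem theorem3p1 (α₁ α₂ : ℝ) (hα₁ : 0 < α₁) (hα₂ : 0 < α₂)
    (c₁ c₂ : ℝ) (hc₁ : c₁ ≠ 0) (hc₂ : c₂ ≠ 0)
    (S : Matrix (Fin 2) (Fin 2) ℝ) (hS : S.PosSemidef) (hdiag : ∀ i, 0 < S i i)
    {Ω : Type*} [MeasurableSpace Ω] (P : Measure Ω)
    (X : Ω → EuclideanSpace ℝ (Fin 2)) (hX : HasLaw X (multivariateGaussian 0 S) P) :
    HasLaw (fun ω => waldRatio (bivariateMonomial c₁ c₂ α₁ α₂) S (X ω))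
      (chiSquareOne.map (fun w => w / (α₁ + α₂) ^ 2)) P :=
  theorem3p1_general α₁ α₂ (mul_pos hα₁ hα₂) c₁ c₂ hc₁ hc₂ S hS hdiag P X hX
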